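/- Let $E$ be a complex Banach space, and let $\mathscr{L}(E)$ be the space of bounded linear operators on $E$. An operator $T\in\mathscr{L}(E)$ is called power-bounded if $\sup_{n\ge 1}\|T^n\|<\infty$, power-bounded below if $\inf_{n\ge 1}\|T^n x\|>0$ for every $x\in E\setminus\{0\}$, and doubly power-bounded if $T$ is invertible and both $T$ and $T^{-1}$ are power-bounded. We say that $T$ has relatively compact orbits on a subset $A\subseteq E$ if $\{T^n y : n\ge 1\}$ is relatively compact in $E$ for every $y\in A$. Write $\operatorname{rg}(S)$ for the range of an operator $S$, and $\mathrm{c}_0$ for the Banach space of complex null sequences with the supremum norm; $E$ contains a copy of $\mathrm{c}_0$ if some linear subspace of $E$ is linearly homeomorphic to $\mathrm{c}_0$. Consider the following assertions. (a) $E$ does not contain a copy of $\mathrm{c}_0$. (b) For every power-bounded operator $T\in\mathscr{L}(E)$ which is power-bounded below, the following two assertions are equivalent: (i) $T$ has relatively compact orbits on $\operatorname{rg}(I-T^m)$ for some integer $m\ge 1$; (ii) $T$ has relatively compact orbits on $\operatorname{rg}(I-T^m)$ for each integer $m\ge 1$. (c) For every doubly power-bounded operator $T\in\mathscr{L}(E)$,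 assertions (i) and (ii) are equivalent. Then (a) $\Rightarrow$ (b) $\Rightarrow$ (c). If $E$ is separable, then (a), (b) and (c) are equivalent. -/

import Mathlib

open scoped ZeroAtInfty

/-- `E` contains a copy of `c₀`: some linear subspace of `E` is linearly homeomorphic to the
complex Banach space `c₀` (such a subspace is automatically closed in `E`). Since `ℕ` is discrete,
`C₀(ℕ, ℂ)` is the space of complex null sequences with the supremum norm. -/
def ContainsCopyOfC0 (E : Type*) [NormedAddCommGroup E] [NormedSpace ℂ E] : Prop :=
  ∃ F : Submodule ℂ E, Nonempty (C₀(ℕ, ℂ) ≃L[ℂ] F)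

/-- `T` is power-bounded: the operator norms of the powers of `T` are uniformly bounded. -/
def IsPowerBounded {E : Type*} [NormedAddCommGroup E] [NormedSpace ℂ E] (T : E →L[ℂ] E) : Prop :=
  ∃ C : ℝ, ∀ n : ℕ, ‖T ^ n‖ ≤ C

/-- `T` is power-bounded below: `inf_n ‖T ^ n x‖ > 0` for every `x ≠ 0`.
(The term `n = 0` is harmless, because `x ≠ 0`.) -/
def IsPowerBoundedBelow {E : Type*} [NormedAddCommGroup E] [NormedSpace ℂ E]
    (T : E →L[ℂ] E) : Prop :=
  ∀ x : E, x ≠ 0 → 0 < ⨅ n : ℕ, ‖(T ^ n) x‖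

/-- `T` is doubly power-bounded: `T` is invertible (with bounded inverse), and both `T` and its
inverse are power-bounded. -/
def IsDoublyPowerBounded {E : Type*} [NormedAddCommGroup E] [NormedSpace ℂ E]
    (T : E →L[ℂ] E) : Prop :=
  ∃ U : (E →L[ℂ] E)ˣ, (U : E →L[ℂ] E) = T ∧ IsPowerBounded (U : E →L[ℂ] E) ∧
    IsPowerBounded ((U⁻¹ : (E →L[ℂ] E)ˣ) : E →L[ℂ] E)

/-- `T` has relatively compact orbits on `A`: for every `y ∈ A` the orbit `{T ^ n y}` has compact
closure in `E`. -/
def HasRelCompactOrbitsOn {E : Type*} [NormedAddCommGroup E] [NormedSpace ℂ E]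
    (T : E →L[ℂ] E) (A : Set E) : Prop :=
  ∀ y ∈ A, IsCompact (closure (Set.range fun n : ℕ => (T ^ n) y))

/-- For `T` the following are equivalent: `T` has relatively compact orbits on `rg (I - T ^ m)` for
some positive integer `m`; the same for each positive integer `m`. -/
def SomeIffEachRelCompactOrbits {E : Type*} [NormedAddCommGroup E] [NormedSpace ℂ E]
    (T : E →L[ℂ] E) : Prop :=
  (∃ m : ℕ, 1 ≤ m ∧ HasRelCompactOrbitsOn T (Set.range (1 - T ^ m : E →L[ℂ] E))) ↔
    (∀ m : ℕ, 1 ≤ m → HasRelCompactOrbitsOn T (Set.range (1 - T ^ m : E →L[ℂ] E)))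

/-! For (a) ⇒ (b), put `S = T ^ m`. Condition (i) makes the orbit of `S x - x` relatively compact
for every `x`; a discrete Bohl–Bohr–Kadets theorem upgrades this to the orbit of `x` itself, so (ii)
holds on all of `E`. That theorem compares almost periods. Boundedness below turns two close points
on the orbit of `y = S x - x` into an almost period of `y`. If good almost periods of `y` were not
almost periods of `x`, one could choose times `τ n` with `z n = (S ^ τ n) x - x` bounded away from
zero but almost fixed by `S`. Then finite sums of the `z n` are close to `(S ^ ∑ τ i) x - x`, hence
bounded, and Bessaga–Pełczyński produces a copy of `c₀`.

(b) ⇒ (c) holds because `‖x‖ ≤ ‖T⁻ⁿ‖ ‖Tⁿ x‖`. For (c) ⇒ (a) in a separable space, Sobczyk's theorem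
complements a copy of `c₀ ≃ c`. There, take multiplication by roots of unity tending to `-1`, and
extend it by the identity. The range of `I - T ^ 2` consists of null sequences, whose orbits are
relatively compact, but the orbit of `(I - T) 1` is not. -/

open Filter Topology

/-! ### Rosenthal's lemma. -/

/-- Rosenthal's disjointification lemma: from a nonnegative matrix with bounded row sums one can
select rows and columns with small off-diagonal row sums. -/
theorem exists_injective_sum_offDiagonal_le {ε : ℝ} (hε : 0 ≤ ε) (r : ℕ) :
    ∀ a : ℕ → ℕ → ℝ, (∀ i j, 0 ≤ a i j) → (∀ i (A : Finset ℕ), ∑ j ∈ A, a i j ≤ r * ε) →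
      ∃ σ : ℕ → ℕ, Function.Injective σ ∧
        ∀ i (A : Finset ℕ), i ∉ A → ∑ j ∈ A, a (σ i) (σ j) ≤ ε := by
  induction r with
  | zero =>
    intro a ha h
    refine ⟨id, Function.injective_id, fun i A _ => ?_⟩
    exact (by simpa using h i A : ∑ j ∈ A, a i j ≤ 0).trans hε
  | succ r ih =>
    intro a ha h
    -- `Nat.pair` splits `ℕ` into infinitely many blocks. If no block works, keep one bad row `q p`
    -- from each block `p`: that row spends more than `ε` on `A p`, inside its own block and off the
    -- kept indices, so only `r * ε` remains for the latter.
    by_cases hp : ∃ p, ∀ i (A : Finset ℕ), i ∉ A →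
        ∑ j ∈ A, a (Nat.pair p i) (Nat.pair p j) ≤ ε
    · obtain ⟨p, hp⟩ := hp
      exact ⟨Nat.pair p, fun i j hij => (Nat.pair_eq_pair.1 hij).2, hp⟩
    · push Not at hp
      choose q A hqA hA using hp
      let τ : ℕ → ℕ := fun p => Nat.pair p (q p)
      have hτ : Function.Injective τ := fun i j hij => (Nat.pair_eq_pair.1 hij).1
      obtain ⟨σ, hσ, hs⟩ := ih (fun i j => a (τ i) (τ j)) (fun i j => ha _ _) (by
        intro i B
        have hpair : Function.Injective (Nat.pair i) := fun j k hjk => (Nat.pair_eq_pair.1 hjk).2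
        have hd : Disjoint (B.map ⟨τ, hτ⟩) ((A i).map ⟨Nat.pair i, hpair⟩) := by
          rw [Finset.disjoint_left]
          intro x hx hx'
          obtain ⟨j, -, rfl⟩ := Finset.mem_map.1 hx
          obtain ⟨k, hk, hjk⟩ := Finset.mem_map.1 hx'
          obtain ⟨rfl, rfl⟩ := Nat.pair_eq_pair.1 hjk
          exact hqA _ hk
        have h1 := h (τ i) (B.map ⟨τ, hτ⟩ ∪ (A i).map ⟨Nat.pair i, hpair⟩)
        rw [Finset.sum_union hd, Finset.sum_map, Finset.sum_map] at h1
        have h2 := hA i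
        push_cast at h1
        simp only [Function.Embedding.coeFn_mk] at h1
        linarith)
      exact ⟨τ ∘ σ, hτ.comp hσ, hs⟩

/-! ### Weakly unconditionally Cauchy series and the Bessaga–Pełczyński theorem. -/

section WeaklyUnconditionallyCauchy

variable {E : Type*} [NormedAddCommGroup E] [NormedSpace ℂ E]

theorem sum_abs_le_two_mul_of_abs_sum_le {ι : Type*} {u : ι → ℝ} {M : ℝ} {A : Finset ι}
    (h : ∀ B ⊆ A, |∑ i ∈ B, u i| ≤ M) : ∑ i ∈ A, |u i| ≤ 2 * M := by
  have h1 := (abs_le.1 (h (A.filter fun i => 0 ≤ u i) (Finset.filter_subset _ _))).2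
  have h2 := (abs_le.1 (h (A.filter fun i => ¬ 0 ≤ u i) (Finset.filter_subset _ _))).1
  rw [← Finset.sum_filter_add_sum_filter_not A (fun i => 0 ≤ u i)]
  have e1 : ∑ i ∈ A with 0 ≤ u i, |u i| = ∑ i ∈ A with 0 ≤ u i, u i :=
    Finset.sum_congr rfl fun i hi => abs_of_nonneg (Finset.mem_filter.1 hi).2
  have e2 : ∑ i ∈ A with ¬ 0 ≤ u i, |u i| = - ∑ i ∈ A with ¬ 0 ≤ u i, u i := by
    rw [← Finset.sum_neg_distrib]
    exact Finset.sum_congr rfl fun i hi => abs_of_neg (not_le.1 (Finset.mem_filter.1 hi).2)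
  rw [e1, e2]
  linarith

/-- A family of vectors whose finite partial sums are bounded is weakly absolutely summable. -/
theorem sum_norm_apply_le_of_norm_sum_le {ι : Type*} {x : ι → E} {M : ℝ}
    (h : ∀ A : Finset ι, ‖∑ i ∈ A, x i‖ ≤ M) (f : E →L[ℂ] ℂ) (A : Finset ι) :
    ∑ i ∈ A, ‖f (x i)‖ ≤ ‖f‖ * (4 * M) := by
  have hf : ∀ B : Finset ι, ‖∑ i ∈ B, f (x i)‖ ≤ ‖f‖ * M := fun B => by
    rw [← map_sum]
    exact (f.le_opNorm _).trans (mul_le_mul_of_nonneg_left (h B) (norm_nonneg _))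
  have hre : ∑ i ∈ A, |(f (x i)).re| ≤ 2 * (‖f‖ * M) :=
    sum_abs_le_two_mul_of_abs_sum_le fun B _ => by
      rw [← Complex.re_sum]
      exact (Complex.abs_re_le_norm _).trans (hf B)
  have him : ∑ i ∈ A, |(f (x i)).im| ≤ 2 * (‖f‖ * M) :=
    sum_abs_le_two_mul_of_abs_sum_le fun B _ => by
      rw [← Complex.im_sum]
      exact (Complex.abs_im_le_norm _).trans (hf B)
  calc ∑ i ∈ A, ‖f (x i)‖ ≤ ∑ i ∈ A, (|(f (x i)).re| + |(f (x i)).im|) :=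
        Finset.sum_le_sum fun i _ => Complex.norm_le_abs_re_add_abs_im _
    _ ≤ ‖f‖ * (4 * M) := by rw [Finset.sum_add_distrib]; linarith

/-- Test the sum on a norming functional. The factor 4 comes from splitting into real and imaginary
parts, then each by sign. -/
theorem norm_sum_smul_le_of_norm_sum_le {ι : Type*} {x : ι → E} {M : ℝ}
    (h : ∀ A : Finset ι, ‖∑ i ∈ A, x i‖ ≤ M) {c : ι → ℂ} {b : ℝ} (A : Finset ι)
    (hc : ∀ i ∈ A, ‖c i‖ ≤ b) (hb : 0 ≤ b) : ‖∑ i ∈ A, c i • x i‖ ≤ 4 * M * b := by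
  obtain ⟨f, hf, hfx⟩ := exists_dual_vector'' ℂ (∑ i ∈ A, c i • x i)
  have hM : 0 ≤ M := by simpa using h ∅
  have h1 := congrArg norm hfx
  simp only [map_sum, map_smul, Complex.coe_algebraMap, Complex.norm_real, norm_norm,
    smul_eq_mul] at h1
  rw [← h1]
  calc ‖∑ i ∈ A, c i * f (x i)‖ ≤ ∑ i ∈ A, b * ‖f (x i)‖ :=
        norm_sum_le_of_le _ fun i hi => by
          rw [norm_mul]
          exact mul_le_mul_of_nonneg_right (hc i hi) (norm_nonneg _)
    _ = b * ∑ i ∈ A, ‖f (x i)‖ := by rw [Finset.mul_sum]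
    _ ≤ b * (1 * (4 * M)) := by
        refine mul_le_mul_of_nonneg_left ?_ hb
        exact (sum_norm_apply_le_of_norm_sum_le h f A).trans
          (mul_le_mul_of_nonneg_right hf (by positivity))
    _ = 4 * M * b := by ring

theorem ZeroAtInftyContinuousMap.norm_apply_le (c : C₀(ℕ, ℂ)) (n : ℕ) : ‖c n‖ ≤ ‖c‖ :=
  c.toBCF.norm_coe_le_norm n

theorem ZeroAtInftyContinuousMap.norm_le_of_forall {c : C₀(ℕ, ℂ)} {b : ℝ} (hb : 0 ≤ b)
    (h : ∀ n, ‖c n‖ ≤ b) : ‖c‖ ≤ b :=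
  (BoundedContinuousFunction.norm_le (f := c.toBCF) hb).2 h

theorem ZeroAtInftyContinuousMap.tendsto_atTop (c : C₀(ℕ, ℂ)) : Tendsto c atTop (𝓝 0) := by
  have := c.zero_at_infty'
  rwa [cocompact_eq_cofinite, Nat.cofinite_eq_atTop] at this

theorem summable_smul_of_norm_sum_le [CompleteSpace E] {x : ℕ → E} {M : ℝ}
    (h : ∀ A : Finset ℕ, ‖∑ i ∈ A, x i‖ ≤ M) (c : C₀(ℕ, ℂ)) : Summable fun i => c i • x i := by
  have hM : 0 ≤ M := by simpa using h ∅
  rw [summable_iff_vanishing_norm]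
  intro ε hε
  have hb : 0 < ε / (4 * M + 1) := by positivity
  obtain ⟨N, hN⟩ := Metric.tendsto_atTop.1 c.tendsto_atTop _ hb
  refine ⟨Finset.range N, fun A hA => ?_⟩
  refine (norm_sum_smul_le_of_norm_sum_le h (b := ε / (4 * M + 1)) A (fun i hi => ?_)
    hb.le).trans_lt ?_
  · have hi' : i ∉ Finset.range N := Finset.disjoint_left.1 hA hi
    simpa using (hN i (by simpa using hi')).le
  · rw [mul_div_assoc', div_lt_iff₀ (by positivity)]
    nlinarith

/-- The operator `c ↦ ∑ cᵢ xᵢ` from `c₀` defined by a family with bounded finite partial sums. -/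
noncomputable def sumSMulCLM [CompleteSpace E] {x : ℕ → E} {M : ℝ}
    (h : ∀ A : Finset ℕ, ‖∑ i ∈ A, x i‖ ≤ M) : C₀(ℕ, ℂ) →L[ℂ] E :=
  LinearMap.mkContinuous
    { toFun := fun c => ∑' i, c i • x i
      map_add' := fun c d => by
        rw [← (summable_smul_of_norm_sum_le h c).tsum_add (summable_smul_of_norm_sum_le h d)]
        exact tsum_congr fun i => by simp [add_smul]
      map_smul' := fun a c => by
        rw [RingHom.id_apply, ← (summable_smul_of_norm_sum_le h c).tsum_const_smul]
        exact tsum_congr fun i => by simp [mul_smul] }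
    (4 * M) fun c =>
      le_of_tendsto (summable_smul_of_norm_sum_le h c).hasSum.norm <|
        Eventually.of_forall fun A =>
          norm_sum_smul_le_of_norm_sum_le h A (fun i _ => c.norm_apply_le i) (norm_nonneg c)

theorem containsCopyOfC0_of_antilipschitz [CompleteSpace E] (J : C₀(ℕ, ℂ) →L[ℂ] E) {K : NNReal}
    (hJ : AntilipschitzWith K J) : ContainsCopyOfC0 E :=
  ⟨_, ⟨J.equivRange hJ.injective (hJ.isClosed_range J.uniformContinuous)⟩⟩

/-- Bessaga–Pełczyński: a sequence which is bounded away from zero and has bounded finite partial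
sums forces the space to contain a copy of `c₀`. -/
theorem containsCopyOfC0_of_norm_sum_le [CompleteSpace E] {x : ℕ → E} {M δ : ℝ} (hδ : 0 < δ)
    (hx : ∀ i, δ ≤ ‖x i‖) (h : ∀ A : Finset ℕ, ‖∑ i ∈ A, x i‖ ≤ M) : ContainsCopyOfC0 E := by
  have hM : 0 ≤ M := by simpa using h ∅
  choose f hf hfx using fun i => exists_dual_vector'' ℂ (x i)
  -- Row sums of `‖f i (x j)‖` are at most `4 * M`; `r` expresses this bound in units of `δ / 2`.
  obtain ⟨r, hr⟩ := exists_nat_ge (4 * M / (δ / 2))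
  rw [div_le_iff₀ (by positivity)] at hr
  obtain ⟨σ, hσ, hs⟩ := exists_injective_sum_offDiagonal_le (half_pos hδ).le r
    (fun i j => ‖f i (x j)‖) (fun _ _ => norm_nonneg _) (fun i A =>
      (sum_norm_apply_le_of_norm_sum_le h (f i) A).trans <|
        (mul_le_of_le_one_left (by positivity) (hf i)).trans hr)
  have h' : ∀ A : Finset ℕ, ‖∑ i ∈ A, x (σ i)‖ ≤ M := fun A => by
    simpa using h (A.map ⟨σ, hσ⟩)
  -- Apply the norming functional of `x (σ i)`: the diagonal term is at least `δ * ‖c i‖`, and the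
  -- others total at most half of `δ * ‖c‖`. The supremum over `i` then bounds `‖c‖` by `2 / δ`
  -- times the norm of the image.
  have lower : ∀ (c : C₀(ℕ, ℂ)) (i : ℕ), δ * ‖c i‖ ≤ ‖sumSMulCLM h' c‖ + ‖c‖ * (δ / 2) := by
    intro c i
    have hsum := summable_smul_of_norm_sum_le h' c
    have hsub : ‖sumSMulCLM h' c‖ ≥ ‖f (σ i) (sumSMulCLM h' c)‖ :=
      ((f (σ i)).le_opNorm _).trans (mul_le_of_le_one_left (norm_nonneg _) (hf _))
    have hlim : Tendsto (fun A : Finset ℕ => ‖f (σ i) (∑ j ∈ A, c j • x (σ j))‖) atTop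
        (𝓝 ‖f (σ i) (sumSMulCLM h' c)‖) :=
      (((f (σ i)).continuous.tendsto _).comp hsum.hasSum).norm
    have : δ * ‖c i‖ - ‖c‖ * (δ / 2) ≤ ‖f (σ i) (sumSMulCLM h' c)‖ := by
      refine ge_of_tendsto hlim ?_
      filter_upwards [eventually_ge_atTop {i}] with A hA
      have hi : i ∈ A := hA (Finset.mem_singleton_self i)
      rw [← Finset.add_sum_erase A _ hi, map_add, map_smul, map_sum]
      have e1 : δ * ‖c i‖ ≤ ‖c i • f (σ i) (x (σ i))‖ := by
        rw [norm_smul, hfx, mul_comm]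
        refine mul_le_mul_of_nonneg_left ?_ (norm_nonneg _)
        simpa using hx (σ i)
      have e2 : ‖∑ j ∈ A.erase i, f (σ i) (c j • x (σ j))‖ ≤ ‖c‖ * (δ / 2) := by
        refine (norm_sum_le_of_le (f := fun j => f (σ i) (c j • x (σ j)))
          (n := fun j => ‖c‖ * ‖f (σ i) (x (σ j))‖) _ fun j _ => ?_).trans ?_
        · rw [map_smul, norm_smul]
          exact mul_le_mul_of_nonneg_right (c.norm_apply_le j) (norm_nonneg _)
        · rw [← Finset.mul_sum]
          exact mul_le_mul_of_nonneg_left (hs i _ (Finset.notMem_erase i A)) (norm_nonneg _)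
      have e3 := norm_sub_le_norm_add (c i • f (σ i) (x (σ i)))
        (∑ j ∈ A.erase i, f (σ i) (c j • x (σ j)))
      linarith
    linarith
  refine containsCopyOfC0_of_antilipschitz (sumSMulCLM h') (K := (2 / δ).toNNReal)
    (AddMonoidHomClass.antilipschitz_of_bound _ fun c => ?_)
  rw [Real.coe_toNNReal _ (by positivity)]
  have h1 : ‖c‖ ≤ (‖sumSMulCLM h' c‖ + ‖c‖ * (δ / 2)) / δ :=
    ZeroAtInftyContinuousMap.norm_le_of_forall (by positivity) fun i => by
      rw [le_div_iff₀ hδ, mul_comm]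
      exact lower c i
  rw [le_div_iff₀ hδ] at h1
  rw [div_mul_eq_mul_div, le_div_iff₀ hδ]
  linarith

end WeaklyUnconditionallyCauchy

/-! ### Almost periods and the implications (a) ⇒ (b) ⇒ (c). -/

section Orbits

variable {E : Type*} [NormedAddCommGroup E] [NormedSpace ℂ E]

/-- Telescope into `s` terms `(T ^ i) (T z - z)`: a nearly fixed vector stays nearly fixed over
bounded times. -/
theorem norm_pow_apply_sub_le {T : E →L[ℂ] E} {C : ℝ} (hC : ∀ n, ‖T ^ n‖ ≤ C) (z : E) (s : ℕ) :
    ‖(T ^ s) z - z‖ ≤ s * (C * ‖T z - z‖) := by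
  induction s with
  | zero => simp
  | succ s ih =>
    have h1 : (T ^ (s + 1)) z - z = (T ^ s) (T z - z) + ((T ^ s) z - z) := by
      rw [pow_succ, mul_apply_eq_comp, map_sub]; abel
    have h2 : ‖(T ^ s) (T z - z)‖ ≤ C * ‖T z - z‖ := (T ^ s).le_of_opNorm_le (hC s) _
    rw [h1, Nat.cast_succ]
    linarith [norm_add_le ((T ^ s) (T z - z)) ((T ^ s) z - z)]

/-- For a vector with relatively compact orbit, two close points of the orbit yield a uniform
almost period. -/
theorem exists_norm_pow_sub_apply_lt {T : E →L[ℂ] E} (hT : IsPowerBounded T)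
    (hT' : IsPowerBoundedBelow T) {y : E}
    (hy : IsCompact (closure (Set.range fun n : ℕ => (T ^ n) y))) {ε : ℝ} (hε : 0 < ε) :
    ∃ η > 0, ∀ m k : ℕ, ‖(T ^ (m + k)) y - (T ^ m) y‖ < η → ‖(T ^ k) y - y‖ < ε := by
  obtain ⟨C, hC⟩ := hT
  by_contra! hcon
  -- Let `v` be a limit of the points `(T ^ k n) y`. It stays at distance at least `ε` from `y`, yet
  -- `T ^ m n` makes `v - y` arbitrarily small along a subsequence, contradicting boundedness below.
  choose m k hmk hk using fun n : ℕ => hcon (1 / ((n : ℝ) + 1)) Nat.one_div_pos_of_nat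
  obtain ⟨v, -, φ, hφ, hv⟩ := hy.tendsto_subseq
    (x := fun n => (T ^ k n) y) fun n => subset_closure ⟨k n, rfl⟩
  have hw : ε ≤ ‖v - y‖ :=
    ge_of_tendsto (hv.sub_const y).norm (Eventually.of_forall fun n => hk (φ n))
  have hw0 : v - y ≠ 0 := norm_pos_iff.1 (hε.trans_le hw)
  have hlim : Tendsto (fun n => 1 / ((φ n : ℝ) + 1) + C * ‖(T ^ k (φ n)) y - v‖) atTop
      (𝓝 (0 + C * 0)) := by
    refine Tendsto.add ?_ (Tendsto.const_mul C ?_)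
    · exact tendsto_one_div_add_atTop_nhds_zero_nat.comp hφ.tendsto_atTop
    · exact tendsto_iff_norm_sub_tendsto_zero.1 hv
  have hle : ∀ n, ⨅ j : ℕ, ‖(T ^ j) (v - y)‖ ≤
      1 / ((φ n : ℝ) + 1) + C * ‖(T ^ k (φ n)) y - v‖ := fun n => by
    have hb : BddBelow (Set.range fun j : ℕ => ‖(T ^ j) (v - y)‖) :=
      ⟨0, by rintro _ ⟨j, rfl⟩; exact norm_nonneg _⟩
    refine (ciInf_le hb (m (φ n))).trans ?_
    have e : (T ^ m (φ n)) (v - y) = ((T ^ (m (φ n) + k (φ n))) y - (T ^ m (φ n)) y) -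
        (T ^ m (φ n)) ((T ^ k (φ n)) y - v) := by
      rw [pow_add, mul_apply_eq_comp, map_sub, map_sub]; abel
    rw [e]
    exact (norm_sub_le _ _).trans (add_le_add (hmk (φ n)).le
      ((T ^ m (φ n)).le_of_opNorm_le (hC _) _))
  have := ge_of_tendsto hlim (Eventually.of_forall hle)
  have hpos := hT' _ hw0
  linarith

/-- If `E` contains no copy of `c₀` and `T` is power-bounded, then sufficiently good almost periods
of `T x - x` are almost periods of `x`. -/
theorem exists_norm_pow_apply_sub_lt [CompleteSpace E] (hE : ¬ ContainsCopyOfC0 E)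
    {T : E →L[ℂ] E} (hT : IsPowerBounded T) (x : E) {δ : ℝ} (hδ : 0 < δ) :
    ∃ ε > 0, ∀ k : ℕ, ‖(T ^ k) (T x - x) - (T x - x)‖ < ε → ‖(T ^ k) x - x‖ < δ := by
  obtain ⟨C, hC⟩ := hT
  by_contra! hcon
  have hC0 : 0 ≤ C := (norm_nonneg _).trans (hC 0)
  -- With this tolerance, moving the `n`-th vector by any time up to `s` changes it by less than `(1
  -- / 2) ^ n`. The recursion below takes `s` to be the sum of all earlier times.
  have hpos : ∀ n s : ℕ, 0 < (1 / 2 : ℝ) ^ n / (s * C + 1) := fun n s => by positivity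
  choose k hk hkδ using fun n s : ℕ => hcon _ (hpos n s)
  obtain ⟨s, hs0, hs1⟩ : ∃ s : ℕ → ℕ, s 0 = 0 ∧ ∀ n, s (n + 1) = s n + k n (s n) :=
    ⟨fun n => Nat.rec 0 (fun n s => s + k n s) n, rfl, fun _ => rfl⟩
  obtain ⟨τ, hτ⟩ : ∃ τ : ℕ → ℕ, ∀ n, k n (s n) = τ n := ⟨_, fun _ => rfl⟩
  have hs : ∀ n, s n = ∑ i ∈ Finset.range n, τ i := fun n => by
    induction n with
    | zero => exact hs0
    | succ n ih => rw [Finset.sum_range_succ, ← ih, hs1, hτ]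
  have hτε : ∀ n, ‖(T ^ τ n) (T x - x) - (T x - x)‖ * (s n * C + 1) < (1 / 2 : ℝ) ^ n := fun n => by
    rw [← hτ, ← lt_div_iff₀ (by positivity)]
    exact hk n (s n)
  have key : ∀ A : Finset ℕ, ‖∑ i ∈ A, ((T ^ τ i) x - x) - ((T ^ (∑ i ∈ A, τ i)) x - x)‖ ≤
      ∑ i ∈ A, (1 / 2 : ℝ) ^ i := by
    intro A
    -- The largest index is added last, so the time `t` already accumulated is at most `s n`, within
    -- the range the tolerance controls.
    induction A using Finset.induction_on_max with
    | empty => simp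
    | insert n A hA ih =>
      have hn : n ∉ A := fun h => (hA n h).false
      rw [Finset.sum_insert hn, Finset.sum_insert hn, Finset.sum_insert hn]
      set t := ∑ i ∈ A, τ i with ht
      have hts : t ≤ s n := by
        rw [hs]
        exact Finset.sum_le_sum_of_subset fun i hi => Finset.mem_range.2 (hA i hi)
      have e : (T ^ τ n) x - x + ∑ i ∈ A, ((T ^ τ i) x - x) - ((T ^ (τ n + t)) x - x) =
          (∑ i ∈ A, ((T ^ τ i) x - x) - ((T ^ t) x - x)) -
            ((T ^ t) ((T ^ τ n) x - x) - ((T ^ τ n) x - x)) := by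
        rw [add_comm (τ n), pow_add, mul_apply_eq_comp, map_sub]; abel
      have e' : T ((T ^ τ n) x - x) - ((T ^ τ n) x - x) =
          (T ^ τ n) (T x - x) - (T x - x) := by
        rw [map_sub, map_sub, ← mul_apply_eq_comp, ← mul_apply_eq_comp,
          ← pow_succ, ← pow_succ']; abel
      have h1 := norm_pow_apply_sub_le hC ((T ^ τ n) x - x) t
      have h2 := hτε n
      have h3 : (t : ℝ) * (C * ‖(T ^ τ n) (T x - x) - (T x - x)‖) ≤
          (s n : ℝ) * (C * ‖(T ^ τ n) (T x - x) - (T x - x)‖) :=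
        mul_le_mul_of_nonneg_right (by exact_mod_cast hts) (by positivity)
      rw [e'] at h1
      have h4 := norm_nonneg ((T ^ τ n) (T x - x) - (T x - x))
      rw [e]
      refine (norm_sub_le _ _).trans ?_
      nlinarith
  refine hE (containsCopyOfC0_of_norm_sum_le (x := fun i => (T ^ τ i) x - x)
    (M := 2 + (C * ‖x‖ + ‖x‖)) hδ (fun i => hτ i ▸ hkδ i (s i)) fun A => ?_)
  have h1 : ∑ i ∈ A, (1 / 2 : ℝ) ^ i ≤ 2 := by
    refine le_of_le_of_eq ?_ tsum_geometric_two
    exact summable_geometric_two.sum_le_tsum A fun i _ => by positivity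
  have h2 : ‖(T ^ (∑ i ∈ A, τ i)) x - x‖ ≤ C * ‖x‖ + ‖x‖ :=
    (norm_sub_le _ _).trans (add_le_add ((T ^ _).le_of_opNorm_le (hC _) _) le_rfl)
  have h3 := norm_sub_norm_le (∑ i ∈ A, ((T ^ τ i) x - x)) ((T ^ (∑ i ∈ A, τ i)) x - x)
  linarith [key A]

/-- A discrete Bohl–Bohr–Kadets theorem. -/
theorem isCompact_closure_orbit_of_sub [CompleteSpace E] (hE : ¬ ContainsCopyOfC0 E)
    {T : E →L[ℂ] E} (hT : IsPowerBounded T) (hT' : IsPowerBoundedBelow T) {x : E}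
    (hx : IsCompact (closure (Set.range fun n : ℕ => (T ^ n) (T x - x)))) :
    IsCompact (closure (Set.range fun n : ℕ => (T ^ n) x)) := by
  have ⟨C, hC⟩ := hT
  have hC0 : 0 ≤ C := (norm_nonneg _).trans (hC 0)
  refine TotallyBounded.isCompact_of_isClosed (TotallyBounded.closure ?_) isClosed_closure
  rw [Metric.totallyBounded_iff]
  intro δ hδ
  obtain ⟨ε, hε, h1⟩ := exists_norm_pow_apply_sub_lt hE hT x
    (show 0 < δ / (C + 1) by positivity)
  obtain ⟨η, hη, h2⟩ := exists_norm_pow_sub_apply_lt hT hT' hx hε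
  -- Closeness on the orbit of `T x - x` forces closeness at the same times on the orbit of `x`, so
  -- a finite net transfers. The divisor `C + 1` above absorbs the factor `T ^ m`.
  have h3 : ∀ m k : ℕ, ‖(T ^ (m + k)) (T x - x) - (T ^ m) (T x - x)‖ < η →
      ‖(T ^ (m + k)) x - (T ^ m) x‖ < δ := fun m k hmk => by
    have h := h1 k (h2 m k hmk)
    rw [lt_div_iff₀ (by positivity)] at h
    rw [pow_add, mul_apply_eq_comp, ← map_sub]
    have := (T ^ m).le_of_opNorm_le (hC m) ((T ^ k) x - x)
    nlinarith [norm_nonneg ((T ^ k) x - x)]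
  have h4 : ∀ m n : ℕ, dist ((T ^ n) (T x - x)) ((T ^ m) (T x - x)) < η →
      dist ((T ^ n) x) ((T ^ m) x) < δ := fun m n hmn => by
    rcases le_total m n with h | h
    · obtain ⟨k, rfl⟩ := Nat.exists_eq_add_of_le h
      rw [dist_eq_norm] at hmn ⊢
      exact h3 m k hmn
    · obtain ⟨k, rfl⟩ := Nat.exists_eq_add_of_le h
      rw [dist_comm, dist_eq_norm] at hmn ⊢
      exact h3 n k hmn
  obtain ⟨t, hts, htf, hcov⟩ := Metric.finite_approx_of_totallyBounded
    (hx.totallyBounded.subset subset_closure) η hη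
  choose! g hg using fun z (hz : z ∈ t) => Set.mem_range.1 (hts hz)
  refine ⟨(fun z => (T ^ g z) x) '' t, htf.image _, ?_⟩
  rintro _ ⟨n, rfl⟩
  obtain ⟨z, hz, hnz⟩ := Set.mem_iUnion₂.1 (hcov ⟨n, rfl⟩)
  refine Set.mem_iUnion₂.2 ⟨_, ⟨z, hz, rfl⟩, h4 _ _ ?_⟩
  rw [hg z hz]
  exact hnz

/-- By division with remainder, the orbit under `T` lies in the images under `T ^ r`, `r < m`, of
the closed orbit under `T ^ m`. -/
theorem isCompact_closure_orbit_of_pow {T : E →L[ℂ] E} {m : ℕ} (hm : 1 ≤ m) {x : E}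
    (hx : IsCompact (closure (Set.range fun n : ℕ => ((T ^ m) ^ n) x))) :
    IsCompact (closure (Set.range fun n : ℕ => (T ^ n) x)) := by
  have hK : IsCompact (⋃ r ∈ Finset.range m,
      (T ^ r) '' closure (Set.range fun n : ℕ => ((T ^ m) ^ n) x)) :=
    (Finset.range m).isCompact_biUnion fun r _ => hx.image (T ^ r).continuous
  refine hK.of_isClosed_subset isClosed_closure (closure_minimal ?_ hK.isClosed)
  rintro _ ⟨n, rfl⟩
  refine Set.mem_iUnion₂.2 ⟨n % m, Finset.mem_range.2 (Nat.mod_lt _ hm), _,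
    subset_closure ⟨n / m, rfl⟩, ?_⟩
  change (T ^ (n % m)) (((T ^ m) ^ (n / m)) x) = (T ^ n) x
  rw [← mul_apply_eq_comp, ← pow_mul, ← pow_add, Nat.mod_add_div]

theorem IsPowerBounded.pow {T : E →L[ℂ] E} (hT : IsPowerBounded T) (m : ℕ) :
    IsPowerBounded (T ^ m) :=
  hT.imp fun _ hC n => by rw [← pow_mul]; exact hC _

theorem IsPowerBoundedBelow.pow {T : E →L[ℂ] E} (hT : IsPowerBoundedBelow T) (m : ℕ) :
    IsPowerBoundedBelow (T ^ m) := fun x hx =>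
  (hT x hx).trans_le <| le_ciInf fun n => by
    rw [← pow_mul]
    exact ciInf_le (f := fun n : ℕ => ‖(T ^ n) x‖)
      ⟨0, by rintro _ ⟨j, rfl⟩; exact norm_nonneg _⟩ (m * n)

theorem someIffEachRelCompactOrbits_of_not_containsCopyOfC0 [CompleteSpace E]
    (hE : ¬ ContainsCopyOfC0 E) {T : E →L[ℂ] E} (hT : IsPowerBounded T)
    (hT' : IsPowerBoundedBelow T) : SomeIffEachRelCompactOrbits T := by
  refine ⟨?_, fun h => ⟨1, le_rfl, h 1 le_rfl⟩⟩
  -- The target exponent and the membership of `y` in the range are dropped: every orbit in `E` is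
  -- relatively compact.
  rintro ⟨m, hm, h⟩ - - y -
  refine isCompact_closure_orbit_of_pow hm
    (isCompact_closure_orbit_of_sub hE (hT.pow m) (hT'.pow m) ?_)
  refine (h ((T ^ m) y - y) ⟨-y, by simp; abel⟩).of_isClosed_subset isClosed_closure
    (closure_mono ?_)
  rintro _ ⟨n, rfl⟩
  exact ⟨m * n, by simp only [pow_mul]⟩

theorem IsDoublyPowerBounded.isPowerBounded {T : E →L[ℂ] E} (hT : IsDoublyPowerBounded T) :
    IsPowerBounded T := by
  obtain ⟨U, rfl, h, -⟩ := hT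
  exact h

theorem IsDoublyPowerBounded.isPowerBoundedBelow {T : E →L[ℂ] E} (hT : IsDoublyPowerBounded T) :
    IsPowerBoundedBelow T := by
  obtain ⟨U, rfl, -, C, hC⟩ := hT
  intro x hx
  have hC0 : 0 ≤ C := (norm_nonneg _).trans (hC 0)
  refine lt_of_lt_of_le (show 0 < ‖x‖ / (C + 1) by positivity) (le_ciInf fun n => ?_)
  rw [div_le_iff₀ (by positivity)]
  have h1 : (((U⁻¹ : (E →L[ℂ] E)ˣ) : E →L[ℂ] E) ^ n) (((U : E →L[ℂ] E) ^ n) x) = x := by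
    rw [← mul_apply_eq_comp, ← Units.val_pow_eq_pow_val, ← Units.val_pow_eq_pow_val,
      inv_pow, Units.inv_mul, one_apply_eq_self]
  have h2 := (((U⁻¹ : (E →L[ℂ] E)ˣ) : E →L[ℂ] E) ^ n).le_of_opNorm_le (hC n)
    (((U : E →L[ℂ] E) ^ n) x)
  rw [h1] at h2
  nlinarith [norm_nonneg (((U : E →L[ℂ] E) ^ n) x)]

end Orbits

/-! ### Sobczyk's theorem, by Veech's argument. -/

/-- In a compact metric space, if all cluster points of a sequence lie in a nonempty set `W`, then
the sequence is asymptotic to a sequence in `W`. -/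
theorem exists_seq_tendsto_dist_zero {X : Type*} [MetricSpace X] [CompactSpace X] {W : Set X}
    (hW : W.Nonempty) {f : ℕ → X}
    (h : ∀ (φ : ℕ → ℕ) (x : X), StrictMono φ → Tendsto (f ∘ φ) atTop (𝓝 x) → x ∈ W) :
    ∃ g : ℕ → X, (∀ n, g n ∈ W) ∧ Tendsto (fun n => dist (f n) (g n)) atTop (𝓝 0) := by
  have key : Tendsto (fun n => Metric.infDist (f n) W) atTop (𝓝 0) := by
    refine tendsto_of_subseq_tendsto fun ns hns => ?_
    obtain ⟨ψ, hψ, hnψ⟩ := strictMono_subseq_of_tendsto_atTop hns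
    obtain ⟨x, φ, hφ, hx⟩ := CompactSpace.tendsto_subseq (f ∘ ns ∘ ψ)
    refine ⟨ψ ∘ φ, ?_⟩
    have hxW : x ∈ W := h (ns ∘ ψ ∘ φ) x (hnψ.comp hφ) hx
    have := ((Metric.continuous_infDist_pt W).tendsto x).comp hx
    rwa [Metric.infDist_zero_of_mem hxW] at this
  have hg : ∀ n : ℕ, ∃ y ∈ W, dist (f n) y < Metric.infDist (f n) W + 1 / ((n : ℝ) + 1) :=
    fun n => (Metric.infDist_lt_iff hW).1 (lt_add_of_pos_right _ Nat.one_div_pos_of_nat)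
  choose g hgW hg using hg
  refine ⟨g, hgW, squeeze_zero (fun _ => dist_nonneg) (fun n => (hg n).le) ?_⟩
  simpa using key.add tendsto_one_div_add_atTop_nhds_zero_nat

section Sobczyk

variable {E : Type*} [NormedAddCommGroup E] [NormedSpace ℂ E]

/-- The operator into `c₀` defined by a bounded weak-* null sequence of functionals. -/
noncomputable def toC0CLM (f : ℕ → E →L[ℂ] ℂ) (M : ℝ) (hM : ∀ n, ‖f n‖ ≤ M)
    (hf : ∀ x, Tendsto (fun n => f n x) atTop (𝓝 0)) : E →L[ℂ] C₀(ℕ, ℂ) :=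
  LinearMap.mkContinuous
    { toFun := fun x =>
        { toFun := fun n => f n x
          continuous_toFun := continuous_of_discreteTopology
          zero_at_infty' := by
            rw [cocompact_eq_cofinite, Nat.cofinite_eq_atTop]
            exact hf x }
      map_add' := fun x y => by ext n; exact map_add (f n) x y
      map_smul' := fun a x => by ext n; exact map_smul (f n) a x }
    M fun x =>
      ZeroAtInftyContinuousMap.norm_le_of_forall
        (mul_nonneg ((norm_nonneg _).trans (hM 0)) (norm_nonneg x))
        fun n => (f n).le_of_opNorm_le (hM n) x

theorem toC0CLM_apply (f : ℕ → E →L[ℂ] ℂ) (M : ℝ) (hM : ∀ n, ‖f n‖ ≤ M)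
    (hf : ∀ x, Tendsto (fun n => f n x) atTop (𝓝 0)) (x : E) (n : ℕ) :
    toC0CLM f M hM hf x n = f n x := rfl

/-- Sobczyk's theorem: in a separable space every copy of `c₀` is complemented. -/
theorem exists_leftInverse_of_containsCopyOfC0 [TopologicalSpace.SeparableSpace E]
    (hE : ContainsCopyOfC0 E) :
    ∃ (J : C₀(ℕ, ℂ) →L[ℂ] E) (P : E →L[ℂ] C₀(ℕ, ℂ)), ∀ c, P (J c) = c := by
  obtain ⟨F, ⟨e⟩⟩ := hE
  let coord : ℕ → C₀(ℕ, ℂ) →L[ℂ] ℂ := fun n =>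
    LinearMap.mkContinuous
      { toFun := fun c => c n, map_add' := fun _ _ => rfl, map_smul' := fun _ _ => rfl } 1
      fun c => by simpa using c.norm_apply_le n
  have hcoord : ∀ n, ‖coord n‖ ≤ 1 := fun n => LinearMap.mkContinuous_norm_le _ zero_le_one _
  -- Hahn–Banach extensions of the coordinate functionals: bounded, but perhaps not weak-* null off
  -- `F`.
  choose f hf hfn using fun n =>
    exists_extension_norm_eq F ((coord n).comp (e.symm : F →L[ℂ] C₀(ℕ, ℂ)))
  set M : ℝ := ‖(e.symm : F →L[ℂ] C₀(ℕ, ℂ))‖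
  have hfM : ∀ n, ‖f n‖ ≤ M := fun n => by
    rw [hfn]
    exact (ContinuousLinearMap.opNorm_comp_le _ _).trans
      (mul_le_of_le_one_left (norm_nonneg _) (hcoord n))
  have hM0 : 0 ≤ M := (norm_nonneg _).trans (hfM 0)
  let K : Set (WeakDual ℂ E) := WeakDual.toStrongDual ⁻¹' Metric.closedBall 0 M
  have hK : IsCompact K := WeakDual.isCompact_closedBall 0 M
  have : CompactSpace K := isCompact_iff_compactSpace.1 hK
  have := WeakDual.metrizable_of_isCompact ℂ E K hK
  let _ := TopologicalSpace.metrizableSpaceMetric K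
  have heval : ∀ x : E, Continuous fun k : K => (k : WeakDual ℂ E) x := fun x =>
    (WeakDual.eval_continuous x).comp continuous_subtype_val
  have hmem : ∀ n, StrongDual.toWeakDual (f n) ∈ K := fun n => by
    simpa [K] using hfM n
  -- Separability makes the dual ball `K` compact metrizable. Coordinates of null sequences vanish
  -- in the limit, so all cluster points of `f` annihilate `F`. Subtracting nearby annihilators `g
  -- n` leaves a weak-* null sequence unchanged on `F`.
  obtain ⟨g, hg, hfg⟩ := exists_seq_tendsto_dist_zero
    (W := {k : K | ∀ v ∈ F, (k : WeakDual ℂ E) v = 0}) (f := fun n => ⟨_, hmem n⟩)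
    ⟨⟨0, by simpa [K] using hM0⟩, fun v _ => rfl⟩ (by
      intro φ k hφ hk v hv
      have h1 := ((heval v).tendsto k).comp hk
      have h2 : Tendsto (fun n => e.symm ⟨v, hv⟩ (φ n)) atTop (𝓝 0) :=
        (e.symm ⟨v, hv⟩).tendsto_atTop.comp hφ.tendsto_atTop
      exact tendsto_nhds_unique h1 (h2.congr fun n => (hf (φ n) ⟨v, hv⟩).symm))
  have hgM : ∀ n, ‖WeakDual.toStrongDual (g n : WeakDual ℂ E)‖ ≤ M := fun n =>
    mem_closedBall_zero_iff.1 (g n).2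
  refine ⟨F.subtypeL.comp (e : C₀(ℕ, ℂ) →L[ℂ] F),
    toC0CLM (fun n => f n - WeakDual.toStrongDual (g n : WeakDual ℂ E)) (M + M)
      (fun n => (norm_sub_le _ _).trans (add_le_add (hfM n) (hgM n))) ?_, ?_⟩
  · intro x
    have huc := CompactSpace.uniformContinuous_of_continuous (heval x)
    rw [Metric.uniformContinuous_iff] at huc
    rw [Metric.tendsto_atTop]
    intro ε hε
    obtain ⟨η, hη, h⟩ := huc ε hε
    obtain ⟨N, hN⟩ := Metric.tendsto_atTop.1 hfg η hη
    refine ⟨N, fun n hn => ?_⟩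
    have h1 := hN n hn
    rw [Real.dist_0_eq_abs, abs_of_nonneg dist_nonneg] at h1
    have h2 := h h1
    rw [dist_eq_norm] at h2
    rw [dist_zero_right]
    exact h2
  · intro c
    ext n
    rw [toC0CLM_apply]
    have h1 := hf n (e c)
    have h2 := hg n (e c) (e c).2
    have h3 : coord n (e.symm (e c)) = c n := by rw [e.symm_apply_apply]; rfl
    change f n (e c) - (g n : WeakDual ℂ E) (e c) = c n
    rw [h2, h1, sub_zero]
    exact h3

end Sobczyk

/-! ### Multiplication operators on convergent sequences, transported to `c₀`. -/

section TriangularOperators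

/-- The coordinates of the image of `y ∈ c₀` under the operator which, through the isomorphism
`c₀ ≃ c`, `(y₀, y₁, …) ↦ (y₁ + y₀, y₂ + y₀, …)`, corresponds to multiplication by the sequence `u`
with limit `l` on the space `c` of convergent sequences. -/
def convMulFun (u : ℕ → ℂ) (l : ℂ) (y : ℕ → ℂ) : ℕ → ℂ
  | 0 => l * y 0
  | n + 1 => u n * y (n + 1) + (u n - l) * y 0

/-- Multiplication by the convergent unimodular sequence `u` on the space of convergent sequences,
transported to `c₀`. -/
noncomputable def convMul (u : ℕ → ℂ) (l : ℂ) (hu : ∀ n, ‖u n‖ = 1) (hl : ‖l‖ = 1)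
    (hul : Tendsto u atTop (𝓝 l)) : C₀(ℕ, ℂ) →L[ℂ] C₀(ℕ, ℂ) :=
  LinearMap.mkContinuous
    { toFun := fun y =>
        { toFun := convMulFun u l y
          continuous_toFun := continuous_of_discreteTopology
          zero_at_infty' := by
            rw [cocompact_eq_cofinite, Nat.cofinite_eq_atTop, ← tendsto_add_atTop_iff_nat 1]
            have h1 := hul.mul ((tendsto_add_atTop_iff_nat 1).2 y.tendsto_atTop)
            have h2 := (hul.sub_const l).mul_const (y 0)
            simpa [convMulFun] using h1.add h2 }
      map_add' := fun x y => by
        ext (_ | n)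
        · exact mul_add _ _ _
        · change u n * (x (n + 1) + y (n + 1)) + (u n - l) * (x 0 + y 0) =
            (u n * x (n + 1) + (u n - l) * x 0) + (u n * y (n + 1) + (u n - l) * y 0)
          ring
      map_smul' := fun a x => by
        ext (_ | n)
        · exact mul_left_comm _ _ _
        · change u n * (a * x (n + 1)) + (u n - l) * (a * x 0) =
            a * (u n * x (n + 1) + (u n - l) * x 0)
          ring }
    3 fun y => by
      refine ZeroAtInftyContinuousMap.norm_le_of_forall (by positivity) ?_
      have h0 := y.norm_apply_le 0
      rintro (_ | n)
      · change ‖l * y 0‖ ≤ _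
        rw [norm_mul, hl]
        linarith [norm_nonneg y]
      · change ‖u n * y (n + 1) + (u n - l) * y 0‖ ≤ _
        have h1 : ‖u n - l‖ ≤ 2 := by
          have := norm_sub_le (u n) l
          rw [hu, hl] at this
          linarith
        have h2 : ‖u n * y (n + 1)‖ ≤ ‖y‖ := by
          rw [norm_mul, hu, one_mul]
          exact y.norm_apply_le _
        have h3 : ‖(u n - l) * y 0‖ ≤ 2 * ‖y‖ := by
          rw [norm_mul]
          exact mul_le_mul h1 h0 (norm_nonneg _) zero_le_two
        linarith [norm_add_le (u n * y (n + 1)) ((u n - l) * y 0)]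

variable {u v : ℕ → ℂ} {l k : ℂ} {hu : ∀ n, ‖u n‖ = 1} {hl : ‖l‖ = 1}
  {hul : Tendsto u atTop (𝓝 l)} {hv : ∀ n, ‖v n‖ = 1} {hk : ‖k‖ = 1}
  {hvk : Tendsto v atTop (𝓝 k)}

theorem convMul_apply_zero (y : C₀(ℕ, ℂ)) : convMul u l hu hl hul y 0 = l * y 0 := rfl

theorem convMul_apply_succ (y : C₀(ℕ, ℂ)) (n : ℕ) :
    convMul u l hu hl hul y (n + 1) = u n * y (n + 1) + (u n - l) * y 0 := rfl

theorem norm_convMul_le : ‖convMul u l hu hl hul‖ ≤ 3 :=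
  LinearMap.mkContinuous_norm_le _ (by norm_num) _

theorem convMul_mul_convMul : convMul u l hu hl hul * convMul v k hv hk hvk =
    convMul (u * v) (l * k) (fun n => by simp [hu, hv]) (by simp [hl, hk]) (hul.mul hvk) := by
  ext y (_ | n)
  · simp only [mul_apply_eq_comp, convMul_apply_zero]; ring
  · simp only [mul_apply_eq_comp, convMul_apply_zero, convMul_apply_succ, Pi.mul_apply]; ring

theorem convMul_one : convMul 1 1 (by simp) (by simp) tendsto_const_nhds = 1 := by
  ext y (_ | n)
  · simp [convMul_apply_zero]
  · simp [convMul_apply_succ]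

theorem convMul_pow (n : ℕ) : convMul u l hu hl hul ^ n =
    convMul (u ^ n) (l ^ n) (fun i => by simp [hu]) (by simp [hl]) (hul.pow n) := by
  induction n with
  | zero => simp only [pow_zero]; exact convMul_one.symm
  | succ n ih => simp only [pow_succ]; rw [ih, convMul_mul_convMul]

/-- Powers and inverses are again multiplications by unimodular convergent sequences, and the norm
bound 3 does not depend on the sequence. -/
theorem isDoublyPowerBounded_convMul : IsDoublyPowerBounded (convMul u l hu hl hul) := by
  have hinv : Tendsto u⁻¹ atTop (𝓝 l⁻¹) := hul.inv₀ (norm_ne_zero_iff.1 (by simp [hl]))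
  have hu0 : ∀ n, u n ≠ 0 := fun n => norm_ne_zero_iff.1 (by simp [hu])
  have hl0 : l ≠ 0 := norm_ne_zero_iff.1 (by simp [hl])
  refine ⟨⟨convMul u l hu hl hul,
    convMul u⁻¹ l⁻¹ (fun n => by simp [hu]) (by simp [hl]) hinv, ?_, ?_⟩, rfl,
    ⟨3, fun n => ?_⟩, ⟨3, fun n => ?_⟩⟩
  · rw [convMul_mul_convMul, ← convMul_one]
    congr 1
    · ext n; simp [hu0]
    · simp [hl0]
  · rw [convMul_mul_convMul, ← convMul_one]
    congr 1
    · ext n; simp [hu0]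
    · simp [hl0]
  · change ‖convMul u l hu hl hul ^ n‖ ≤ 3
    rw [convMul_pow]; exact norm_convMul_le
  · change ‖convMul u⁻¹ l⁻¹ (fun n => by simp [hu]) (by simp [hl]) hinv ^ n‖ ≤ 3
    rw [convMul_pow]; exact norm_convMul_le

end TriangularOperators

/-! ### Extending an operator from a complemented subspace. -/

section Extension

variable {E G : Type*} [NormedAddCommGroup E] [NormedSpace ℂ E] [NormedAddCommGroup G]
  [NormedSpace ℂ G]

/-- The operator acting as `T` on the range of the embedding `J` and as the identity on the kernel
of its left inverse `P`. -/
noncomputable def extendById (J : G →L[ℂ] E) (P : E →L[ℂ] G) (T : G →L[ℂ] G) : E →L[ℂ] E :=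
  1 + J.comp ((T - 1).comp P)

variable {J : G →L[ℂ] E} {P : E →L[ℂ] G}

theorem extendById_apply (T : G →L[ℂ] G) (x : E) :
    extendById J P T x = x + J (T (P x) - P x) := rfl

theorem extendById_one : extendById J P 1 = 1 := by simp [extendById]

theorem extendById_mul (hJP : ∀ c, P (J c) = c) (S T : G →L[ℂ] G) :
    extendById J P (S * T) = extendById J P S * extendById J P T := by
  ext x
  simp only [mul_apply_eq_comp, extendById_apply, map_add, map_sub, hJP]
  abel

theorem extendById_pow (hJP : ∀ c, P (J c) = c) (T : G →L[ℂ] G) (n : ℕ) :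
    extendById J P (T ^ n) = extendById J P T ^ n := by
  induction n with
  | zero => simp only [pow_zero, extendById_one]
  | succ n ih => rw [pow_succ, pow_succ, extendById_mul hJP, ih]

theorem extendById_apply_map (hJP : ∀ c, P (J c) = c) (T : G →L[ℂ] G) (c : G) :
    extendById J P T (J c) = J (T c) := by
  rw [extendById_apply, hJP, map_sub]; abel

theorem IsPowerBounded.extendById (hJP : ∀ c, P (J c) = c) {T : G →L[ℂ] G}
    (hT : IsPowerBounded T) : IsPowerBounded (extendById J P T) := by
  obtain ⟨C, hC⟩ := hT
  refine ⟨‖(1 : E →L[ℂ] E)‖ + ‖J‖ * ((C + ‖(1 : G →L[ℂ] G)‖) * ‖P‖), fun n => ?_⟩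
  rw [← extendById_pow hJP]
  refine (norm_add_le _ _).trans (add_le_add le_rfl ?_)
  refine (J.opNorm_comp_le _).trans (mul_le_mul_of_nonneg_left ?_ (norm_nonneg _))
  refine (ContinuousLinearMap.opNorm_comp_le _ _).trans
    (mul_le_mul_of_nonneg_right ?_ (norm_nonneg _))
  exact (norm_sub_le _ _).trans (add_le_add (hC n) le_rfl)

theorem IsDoublyPowerBounded.extendById (hJP : ∀ c, P (J c) = c) {T : G →L[ℂ] G}
    (hT : IsDoublyPowerBounded T) : IsDoublyPowerBounded (extendById J P T) := by
  obtain ⟨U, rfl, h, h'⟩ := hT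
  refine ⟨⟨_root_.extendById J P U, _root_.extendById J P ((U⁻¹ : (G →L[ℂ] G)ˣ) : G →L[ℂ] G), ?_, ?_⟩, rfl,
    h.extendById hJP, h'.extendById hJP⟩
  · rw [← extendById_mul hJP, Units.mul_inv, extendById_one]
  · rw [← extendById_mul hJP, Units.inv_mul, extendById_one]

/-- Relative compactness of orbits on `rg (I - T ^ m)` transfers between `T` and its extension by
the identity. -/
theorem hasRelCompactOrbitsOn_extendById_iff (hJP : ∀ c, P (J c) = c) (T : G →L[ℂ] G) (m : ℕ) :
    HasRelCompactOrbitsOn (extendById J P T)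
        (Set.range (1 - extendById J P T ^ m : E →L[ℂ] E)) ↔
      HasRelCompactOrbitsOn T (Set.range (1 - T ^ m : G →L[ℂ] G)) := by
  have hpow : ∀ (n : ℕ) (c : G), (extendById J P T ^ n) (J c) = J ((T ^ n) c) := fun n c => by
    rw [← extendById_pow hJP, extendById_apply_map hJP]
  -- The identity part cancels, so the two ranges correspond under `J` and `P`.
  have hsub : ∀ x : E, (1 - extendById J P T ^ m : E →L[ℂ] E) x =
      J ((1 - T ^ m : G →L[ℂ] G) (P x)) := fun x => by
    rw [← extendById_pow hJP]
    simp only [sub_apply, one_apply_eq_self, extendById_apply, map_sub]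
    abel
  constructor
  · rintro h _ ⟨c, rfl⟩
    have hK := (h _ ⟨J c, rfl⟩).image P.continuous
    refine hK.of_isClosed_subset isClosed_closure (closure_minimal ?_ hK.isClosed)
    rintro _ ⟨n, rfl⟩
    refine ⟨_, subset_closure ⟨n, rfl⟩, ?_⟩
    simp only [hsub, hpow, hJP]
  · rintro h _ ⟨x, rfl⟩
    have hK := (h _ ⟨P x, rfl⟩).image J.continuous
    refine hK.of_isClosed_subset isClosed_closure (closure_minimal ?_ hK.isClosed)
    rintro _ ⟨n, rfl⟩
    refine ⟨_, subset_closure ⟨n, rfl⟩, ?_⟩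
    simp only [hsub, hpow]

theorem SomeIffEachRelCompactOrbits.of_extendById (hJP : ∀ c, P (J c) = c) {T : G →L[ℂ] G}
    (h : SomeIffEachRelCompactOrbits (_root_.extendById J P T)) :
    SomeIffEachRelCompactOrbits T := by
  simpa only [SomeIffEachRelCompactOrbits, hasRelCompactOrbitsOn_extendById_iff hJP] using h

end Extension

/-! ### The counterexample on `c₀`. -/

section Counterexample

/-- Roots of unity converging to `-1`. -/
noncomputable def rootSeq (n : ℕ) : ℂ := -Complex.exp ((Real.pi / 2 ^ (n + 1) : ℝ) * Complex.I)

theorem norm_rootSeq (n : ℕ) : ‖rootSeq n‖ = 1 := by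
  rw [rootSeq, norm_neg, Complex.norm_exp_ofReal_mul_I]

theorem tendsto_rootSeq : Tendsto rootSeq atTop (𝓝 (-1)) := by
  have h1 : Tendsto (fun n : ℕ => Real.pi / 2 ^ (n + 1)) atTop (𝓝 0) :=
    Tendsto.div_atTop tendsto_const_nhds
      ((tendsto_pow_atTop_atTop_of_one_lt one_lt_two).comp (tendsto_add_atTop_nat 1))
  have h2 : Continuous fun t : ℝ => -Complex.exp (t * Complex.I) := by fun_prop
  have h3 : -Complex.exp ((0 : ℝ) * Complex.I) = -1 := by simp
  rw [← h3]
  exact (h2.tendsto 0).comp h1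

/-- At time `2 ^ (n + 1)` the `n`-th root flips sign, while at later times `2 ^ (j + 1)` it has
returned to 1; this separates the orbit. -/
theorem rootSeq_pow (n : ℕ) : rootSeq n ^ 2 ^ (n + 1) = -1 := by
  rw [rootSeq, Even.neg_pow (by simp [Nat.even_pow]), ← Complex.exp_nat_mul, ← Complex.exp_pi_mul_I]
  congr 1
  push_cast
  field_simp

theorem rootSeq_pow_eq_one {n j : ℕ} (h : n < j) : rootSeq n ^ 2 ^ (j + 1) = 1 := by
  obtain ⟨i, rfl⟩ := Nat.exists_eq_add_of_lt h
  rw [show n + i + 1 + 1 = n + 1 + (i + 1) by ring, pow_add, pow_mul, rootSeq_pow,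
    Even.neg_one_pow (by simp [Nat.even_pow])]

theorem one_le_norm_one_sub_rootSeq (n : ℕ) : 1 ≤ ‖1 - rootSeq n‖ := by
  refine le_trans ?_ (Complex.re_le_norm _)
  have h1 : Real.pi / 2 ^ (n + 1) ≤ Real.pi / 2 := by
    refine div_le_div_of_nonneg_left Real.pi_pos.le two_pos ?_
    exact le_self_pow₀ one_le_two (Nat.succ_ne_zero n)
  have h2 : 0 ≤ Real.cos (Real.pi / 2 ^ (n + 1)) :=
    Real.cos_nonneg_of_neg_pi_div_two_le_of_le
      (by have := Real.pi_pos; have : 0 < Real.pi / 2 ^ (n + 1) := by positivity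
          linarith) h1
  rw [rootSeq, sub_neg_eq_add, Complex.add_re, Complex.one_re, Complex.exp_ofReal_mul_I_re]
  linarith

/-- A doubly power-bounded operator on `c₀` for which relative compactness of orbits on
`rg (I - T ^ m)` depends on `m`. -/
noncomputable def rootOperator : C₀(ℕ, ℂ) →L[ℂ] C₀(ℕ, ℂ) :=
  convMul rootSeq (-1) norm_rootSeq (by simp) tendsto_rootSeq

theorem rootOperator_pow_apply_zero (n : ℕ) (y : C₀(ℕ, ℂ)) :
    (rootOperator ^ n) y 0 = (-1) ^ n * y 0 := by
  rw [rootOperator, convMul_pow, convMul_apply_zero]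

theorem rootOperator_pow_apply_succ (n : ℕ) (y : C₀(ℕ, ℂ)) (i : ℕ) :
    (rootOperator ^ n) y (i + 1) =
      rootSeq i ^ n * y (i + 1) + (rootSeq i ^ n - (-1) ^ n) * y 0 := by
  rw [rootOperator, convMul_pow, convMul_apply_succ, Pi.pow_apply]

/-- The hypothesis says that the limit coordinate vanishes. The roots of index below `N` have common
period `2 ^ (N + 1)`, and the tail of `g` is uniformly small, so finitely many orbit points form a
net. -/
theorem isCompact_closure_orbit_rootOperator {g : C₀(ℕ, ℂ)} (hg : g 0 = 0) :
    IsCompact (closure (Set.range fun n : ℕ => (rootOperator ^ n) g)) := by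
  refine TotallyBounded.isCompact_of_isClosed (TotallyBounded.closure ?_) isClosed_closure
  rw [Metric.totallyBounded_iff]
  intro ε hε
  obtain ⟨N, hN⟩ := Metric.tendsto_atTop.1 g.tendsto_atTop (ε / 3) (by positivity)
  refine ⟨(fun r => (rootOperator ^ r) g) '' Finset.range (2 ^ (N + 1)),
    (Finset.finite_toSet _).image _, ?_⟩
  rintro _ ⟨n, rfl⟩
  refine Set.mem_iUnion₂.2 ⟨_, ⟨n % 2 ^ (N + 1),
    Finset.mem_coe.2 (Finset.mem_range.2 (Nat.mod_lt _ (by positivity))), rfl⟩, ?_⟩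
  rw [Metric.mem_ball, dist_eq_norm]
  refine (ZeroAtInftyContinuousMap.norm_le_of_forall (b := 2 * (ε / 3)) (by positivity)
    ?_).trans_lt (by linarith)
  rintro (_ | i)
  · simp only [ZeroAtInftyContinuousMap.sub_apply, rootOperator_pow_apply_zero, hg, mul_zero,
      sub_zero, norm_zero]
    positivity
  · simp only [ZeroAtInftyContinuousMap.sub_apply, rootOperator_pow_apply_succ, hg, mul_zero,
      add_zero]
    rcases lt_or_ge i N with hi | hi
    · have : rootSeq i ^ n = rootSeq i ^ (n % 2 ^ (N + 1)) := by
        conv_lhs => rw [← Nat.mod_add_div n (2 ^ (N + 1)), pow_add, pow_mul,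
          rootSeq_pow_eq_one hi, one_pow, mul_one]
      rw [this, sub_self, norm_zero]
      positivity
    · have h1 := hN (i + 1) (by omega)
      rw [dist_zero_right] at h1
      refine (norm_sub_le _ _).trans ?_
      simp only [norm_mul, norm_pow, norm_rootSeq, one_pow, one_mul]
      linarith

/-- The limit coordinate is killed because `1 - (-1) ^ 2 = 0`. -/
theorem hasRelCompactOrbitsOn_rootOperator_two :
    HasRelCompactOrbitsOn rootOperator
      (Set.range (1 - rootOperator ^ 2 : C₀(ℕ, ℂ) →L[ℂ] C₀(ℕ, ℂ))) := by
  rintro _ ⟨y, rfl⟩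
  refine isCompact_closure_orbit_rootOperator ?_
  rw [sub_apply, one_apply_eq_self, ZeroAtInftyContinuousMap.sub_apply,
    rootOperator_pow_apply_zero]
  ring

theorem not_hasRelCompactOrbitsOn_rootOperator_one :
    ¬ HasRelCompactOrbitsOn rootOperator
      (Set.range (1 - rootOperator ^ 1 : C₀(ℕ, ℂ) →L[ℂ] C₀(ℕ, ℂ))) := by
  intro h
  -- In the model `c`, this is the constant sequence 1, and `w` below is `1 - rootSeq`, with limit
  -- 2.
  let y : C₀(ℕ, ℂ) :=
    { toFun := Pi.single 0 1
      continuous_toFun := continuous_of_discreteTopology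
      zero_at_infty' := by
        rw [cocompact_eq_cofinite, Nat.cofinite_eq_atTop, ← tendsto_add_atTop_iff_nat 1]
        simp }
  have hy0 : y 0 = 1 := Pi.single_eq_same (M := fun _ : ℕ => ℂ) 0 1
  have hy1 : ∀ i, y (i + 1) = 0 := fun i =>
    Pi.single_eq_of_ne (M := fun _ : ℕ => ℂ) (Nat.succ_ne_zero i) 1
  set w := (1 - rootOperator ^ 1 : C₀(ℕ, ℂ) →L[ℂ] C₀(ℕ, ℂ)) y with hw
  have hw0 : w 0 = 2 := by
    rw [hw, sub_apply, one_apply_eq_self, ZeroAtInftyContinuousMap.sub_apply,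
      rootOperator_pow_apply_zero, hy0]
    norm_num
  have hw1 : ∀ i, w (i + 1) = -(rootSeq i + 1) := fun i => by
    rw [hw, sub_apply, one_apply_eq_self, ZeroAtInftyContinuousMap.sub_apply,
      rootOperator_pow_apply_succ, hy0, hy1]
    ring
  obtain ⟨z, -, φ, hφ, hz⟩ := (h w ⟨y, rfl⟩).tendsto_subseq
    (x := fun j => (rootOperator ^ 2 ^ (j + 1)) w) fun j => subset_closure ⟨2 ^ (j + 1), rfl⟩
  obtain ⟨N, hN⟩ := Metric.cauchySeq_iff.1 hz.cauchySeq 2 two_pos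
  have h1 := hN N le_rfl (N + 1) (Nat.le_succ N)
  have hlt : φ N < φ (N + 1) := hφ (Nat.lt_succ_self N)
  set i := φ N
  set j := φ (N + 1)
  -- For `i < j`, coordinate `i + 1` differs by `2 * ‖1 - rootSeq i‖ ≥ 2` between the times `2 ^ (i
  -- + 1)` and `2 ^ (j + 1)`, so no subsequence is Cauchy.
  have h2 : ‖(rootOperator ^ 2 ^ (i + 1)) w (i + 1) - (rootOperator ^ 2 ^ (j + 1)) w (i + 1)‖ < 2 :=
    (ZeroAtInftyContinuousMap.norm_apply_le
      ((rootOperator ^ 2 ^ (i + 1)) w - (rootOperator ^ 2 ^ (j + 1)) w) (i + 1)).trans_lt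
      (by rw [← dist_eq_norm]; exact h1)
  have heven : ∀ j : ℕ, (-1 : ℂ) ^ 2 ^ (j + 1) = 1 := fun j =>
    Even.neg_one_pow (by simp [Nat.even_pow])
  rw [rootOperator_pow_apply_succ, rootOperator_pow_apply_succ, rootSeq_pow,
    rootSeq_pow_eq_one hlt, heven, heven, hw0, hw1] at h2
  rw [show -1 * -(rootSeq i + 1) + (-1 - 1) * 2 - (1 * -(rootSeq i + 1) + (1 - 1) * 2) =
    -2 * (1 - rootSeq i) by ring, norm_mul, norm_neg, Complex.norm_ofNat] at h2
  linarith [one_le_norm_one_sub_rootSeq i]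

end Counterexample

/-! ### The implication (c) ⇒ (a) and the main theorem. -/

theorem not_containsCopyOfC0_of_someIffEachRelCompactOrbits {E : Type*} [NormedAddCommGroup E]
    [NormedSpace ℂ E] [TopologicalSpace.SeparableSpace E]
    (h : ∀ T : E →L[ℂ] E, IsDoublyPowerBounded T → SomeIffEachRelCompactOrbits T) :
    ¬ ContainsCopyOfC0 E := by
  intro hE
  obtain ⟨J, P, hJP⟩ := exists_leftInverse_of_containsCopyOfC0 hE
  have hT : IsDoublyPowerBounded rootOperator := isDoublyPowerBounded_convMul
  exact not_hasRelCompactOrbitsOn_rootOperator_one <|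
    (SomeIffEachRelCompactOrbits.of_extendById hJP (h _ (hT.extendById hJP))).1
      ⟨2, one_le_two, hasRelCompactOrbitsOn_rootOperator_two⟩ 1 le_rfl

theorem theorem4p2 (E : Type*) [NormedAddCommGroup E] [NormedSpace ℂ E] [CompleteSpace E] :
    (¬ ContainsCopyOfC0 E →
      ∀ T : E →L[ℂ] E, IsPowerBounded T → IsPowerBoundedBelow T →
        SomeIffEachRelCompactOrbits T) ∧
    ((∀ T : E →L[ℂ] E, IsPowerBounded T → IsPowerBoundedBelow T →
        SomeIffEachRelCompactOrbits T) →
      ∀ T : E →L[ℂ] E, IsDoublyPowerBounded T → SomeIffEachRelCompactOrbits T) ∧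
    (TopologicalSpace.SeparableSpace E →
      List.TFAE [
        ¬ ContainsCopyOfC0 E,
        ∀ T : E →L[ℂ] E, IsPowerBounded T → IsPowerBoundedBelow T →
          SomeIffEachRelCompactOrbits T,
        ∀ T : E →L[ℂ] E, IsDoublyPowerBounded T → SomeIffEachRelCompactOrbits T]) := by
  have hab : ¬ ContainsCopyOfC0 E → ∀ T : E →L[ℂ] E, IsPowerBounded T → IsPowerBoundedBelow T →
      SomeIffEachRelCompactOrbits T :=
    fun hE _ hT hT' => someIffEachRelCompactOrbits_of_not_containsCopyOfC0 hE hT hT'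
  have hbc : (∀ T : E →L[ℂ] E, IsPowerBounded T → IsPowerBoundedBelow T →
      SomeIffEachRelCompactOrbits T) →
        ∀ T : E →L[ℂ] E, IsDoublyPowerBounded T → SomeIffEachRelCompactOrbits T :=
    fun h T hT => h T hT.isPowerBounded hT.isPowerBoundedBelow
  refine ⟨hab, hbc, fun _ => ?_⟩
  tfae_have 1 → 2 := hab
  tfae_have 2 → 3 := hbc
  tfae_have 3 → 1 := not_containsCopyOfC0_of_someIffEachRelCompactOrbits
  tfae_finish
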